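/- Let $ABC$ be a non-degenerate triangle in the Euclidean plane with incenter $I$. Let $\omega_a$ be a circle tangent to the lines $AB$ and $AC$ (possibly degenerate: the point $A$), and let $\Omega$ be a circle through $B$ and $C$ that touches $\omega_a$ at a point $A'$. Let $k$ be a line tangent to $\omega_a$, and let $\omega$ be a circle of positive radius, lying on the same side of line $BC$ as $A$, which touches the segment $BC$ at $D$, the circle $\Omega$ at $P$, and the line $k$ at $E$. Assume that one of the following holds. 1. $\omega_a$ has positive radius and lies in the angle vertical to $\angle BAC$ (its center is on the opposite side of $AC$ from $B$ and on the opposite side of $AB$ from $C$), $\omega_a$ is internally tangent to $\Omega$ (inside $\Omega$), and $\omega$ lies on the same side of $k$ as $\omega_a$. 2. $\omega_a$ has positive radius and lies in the angle $BAC$ (its center is on the same side of $AC$ as $B$, on the same side of $AB$ as $C$, and on the same side of $BC$ as $A$), $\omega_a$ is externally tangent to $\Omega$, and $\omega$ lies on the opposite side of $k$ from $\omega_a$. 3. $\omega_a$ is the point $A$ (so $A'=A$, $\Omega$ is the circumcircle of $ABC$, and $k$ is a line through $A$). Assume moreover that, of the two common tangents of $\omega_a$ and $\omega$ allowed by this description,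 $k$ is the one that touches $\omega$ on the side of $BC$; that is, either $A'=P$, or the points $E$ and $D$ lie strictly on the same side of the line $A'P$. Then $D\neq E$, and the line $DE$ passes through the incenter $I$ of triangle $ABC$, whatever the choice of the line $k$. -/

import Mathlib

open EuclideanGeometry Affine

/-- The Euclidean plane. -/
abbrev Plane : Type := EuclideanSpace ℝ (Fin 2)

/-- Two circles touch at `p`: externally, or internally with either one inside the other. -/
def CirclesTouchAt (s t : Sphere Plane) (p : Plane) : Prop :=
  s.IsExtTangentAt t p ∨ s.IsIntTangentAt t p ∨ t.IsIntTangentAt s p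

/-- First configuration: `ωa` lies in the angle vertical to the angle `BAC`, it touches `Ω`
internally at `A'`, and `ω` lies on the same side of `k` as `ωa`. -/
structure VerticalConfig (A B C : Plane) (ωa Ω ω : Sphere Plane) (k : AffineSubspace ℝ Plane)
    (A' : Plane) : Prop where
  radius_pos : 0 < ωa.radius
  opp_AC : line[ℝ, A, C].SOppSide ωa.center B
  opp_AB : line[ℝ, A, B].SOppSide ωa.center C
  touch : ωa.IsIntTangentAt Ω A'
  side_k : k.SSameSide ω.center ωa.center

/-- Second configuration: `ωa` lies in the angle `BAC`, on the same side of `BC` as `A`, it touches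
`Ω` externally at `A'`, and `ω` lies on the opposite side of `k` from `ωa`. -/
structure InnerConfig (A B C : Plane) (ωa Ω ω : Sphere Plane) (k : AffineSubspace ℝ Plane)
    (A' : Plane) : Prop where
  radius_pos : 0 < ωa.radius
  same_AC : line[ℝ, A, C].SSameSide ωa.center B
  same_AB : line[ℝ, A, B].SSameSide ωa.center C
  same_BC : line[ℝ, B, C].SSameSide ωa.center A
  touch : ωa.IsExtTangentAt Ω A'
  side_k : k.SOppSide ω.center ωa.center

/-- Degenerate configuration: `ωa` has radius zero (so, being tangent to the lines `AB` and `AC`, it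
is the point `A`), and `Ω` passes through this point, which is `A'`. -/
structure PointConfig (ωa Ω : Sphere Plane) (A' : Plane) : Prop where
  radius_zero : ωa.radius = 0
  mem_left : A' ∈ ωa
  mem_right : A' ∈ Ω

/-! The proof is a computation. Put `D` at the origin and `BC` on the first axis: `B = (b, 0)`, `C =
(c, 0)`, `ω` has center `(0, ρ)`, the incenter is `(p, r)`, and `Ω` has radius `R`. Give `ωa` a
signed radius `s`, positive in the vertical angle, negative in the angle `BAC`, zero for the point
`A`. Then all three configurations satisfy the same equations (`exists_signed_radius`).

The center `(u, v)` of `ωa` lies on the bisector through `A` and the incenter, so `u`, `v` and `s`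
are affine in one parameter `m`, with `m = 0` at the incenter (`bisector_param`). Tangency of `ωa`
and `Ω` then becomes a quadratic in `m` that factors; positivity kills one factor and the other
gives `ρ = -m * (b * c)`.

Let `n` be the unit normal of `k`, oriented so that `E` is the center of `ω` minus `ρ * n`, and let
`N` join the center of `ω` to that of `ωa`. Tangency to `k` gives the dot product `N · n = s - ρ`,
so the cross product `N × n` is `T` or `-T`, where `T` is the signed length of the common tangent.
The side condition on `A'P` selects `T` (`normal_sign`). These two linear equations determine `n`,
namely `(-2rp, p² - r²) / (p² + r²)` (`contact_identities`, `normal_eq`). Hence `E` is `2ρr / (p² +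
r²)` times the incenter, which is therefore on the line `DE`. -/

/-! ### Real algebra behind the configuration -/

/-- A unit vector `(α, β)` with `α > 0` whose pairing with `(x, r)` is `r` is given by the
half-angle formulas. -/
lemma half_angle_formulas {α β x r : ℝ} (hα : 0 < α) (hr : 0 < r) (hu : α ^ 2 + β ^ 2 = 1)
    (h : α * x + β * r = r) :
    0 < x ∧ α * (x ^ 2 + r ^ 2) = 2 * x * r ∧ β * (x ^ 2 + r ^ 2) = r ^ 2 - x ^ 2 := by
  have hβ : β < 1 := by nlinarith
  have h1 : α * x = r * (1 - β) := by linarith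
  have hx : 0 < x := by
    have : 0 < α * x := by rw [h1]; exact mul_pos hr (by linarith)
    exact pos_of_mul_pos_right this hα.le
  have h2 : x * (1 + β) = r * α := by
    apply mul_left_cancel₀ hα.ne'
    linear_combination (1 + β) * h1 - r * hu
  refine ⟨hx, ?_, ?_⟩
  · linear_combination x * h1 - r * h2
  · linear_combination r * h1 + x * h2

/-- The point at distance `-s` from the sides `AB` and `AC` of a triangle with incenter `(p, r)`,
in terms of the tangent lengths `x` and `y` from `B` and `C`. -/
lemma bisector_param {b c p r u v s α β α' β' : ℝ} (hα : 0 < α) (hα' : 0 < α') (hr : 0 < r)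
    (hu : α ^ 2 + β ^ 2 = 1) (hu' : α' ^ 2 + β' ^ 2 = 1)
    (hI : α * (p - b) + β * r = r) (hI' : α' * (c - p) + β' * r = r)
    (hQ : α * (u - b) + β * v = -s) (hQ' : α' * (c - u) + β' * v = -s) :
    v * ((p - b) * (c - p) - r ^ 2) =
        2 * r * ((p - b) * (c - p)) + s * ((p - b) * (c - p) + r ^ 2) ∧
      (u - p) * ((p - b) * (c - p) - r ^ 2) = - (s + r) * r * (b + c - 2 * p) := by
  obtain ⟨hx, h1, h2⟩ := half_angle_formulas hα hr hu hI
  obtain ⟨hy, h3, h4⟩ := half_angle_formulas hα' hr hu' hI'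
  -- The half-angle formulas remove the normals; the two resulting equations are linear in `u` and
  -- `v`.
  have k1 : 2 * (p - b) * r * (u - b) + (r ^ 2 - (p - b) ^ 2) * v
      = -s * ((p - b) ^ 2 + r ^ 2) := by
    linear_combination ((p - b) ^ 2 + r ^ 2) * hQ - (u - b) * h1 - v * h2
  have k2 : 2 * (c - p) * r * (c - u) + (r ^ 2 - (c - p) ^ 2) * v
      = -s * ((c - p) ^ 2 + r ^ 2) := by
    linear_combination ((c - p) ^ 2 + r ^ 2) * hQ' - (c - u) * h3 - v * h4
  have hv : v * ((p - b) * (c - p) - r ^ 2) =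
      2 * r * ((p - b) * (c - p)) + s * ((p - b) * (c - p) + r ^ 2) := by
    have : (c - b) ≠ 0 := by intro h; linarith
    apply mul_left_cancel₀ this
    linear_combination (-(c - p)) * k1 - (p - b) * k2
  refine ⟨hv, ?_⟩
  apply mul_left_cancel₀ (mul_pos (mul_pos two_pos hx) hr).ne'
  linear_combination ((p - b) * (c - p) - r ^ 2) * k1 - (r ^ 2 - (p - b) ^ 2) * hv

/-- A circle through `(b, 0)` and `(c, 0)` touching the circle of radius `ρ` that rests on the
segment between these points at the origin contains it, and its equation is determined. -/
lemma circle_through_touching {b c o₁ o₂ R ρ : ℝ} (hb : b ≤ 0) (hc : 0 ≤ c) (hbc : b < c)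
    (hρ : 0 < ρ) (hR : 0 < R) (hB : (b - o₁) ^ 2 + o₂ ^ 2 = R ^ 2)
    (hC : (c - o₁) ^ 2 + o₂ ^ 2 = R ^ 2)
    (h : o₁ ^ 2 + (ρ - o₂) ^ 2 = (R - ρ) ^ 2 ∨ o₁ ^ 2 + (ρ - o₂) ^ 2 = (R + ρ) ^ 2) :
    o₁ ^ 2 + (ρ - o₂) ^ 2 = (R - ρ) ^ 2 ∧ b < 0 ∧ 0 < c ∧ 2 * o₁ = b + c ∧
      2 * ρ * (o₂ - R) = b * c := by
  have ho : 2 * o₁ = b + c := by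
    apply mul_left_cancel₀ (sub_pos.2 hbc).ne'
    linear_combination hB - hC
  have hR2 : R ^ 2 = o₂ ^ 2 + ((c - b) / 2) ^ 2 := by
    rw [← hB, show o₁ = (b + c) / 2 by linarith]; ring
  have hpos : 0 < ((c - b) / 2) ^ 2 := by have := sub_pos.2 hbc; positivity
  have hlt : |o₂| < R := abs_lt_of_sq_lt_sq (by linarith) hR.le
  obtain ⟨hl, hu⟩ := abs_lt.1 hlt
  have hbc0 : b * c ≤ 0 := mul_nonpos_of_nonpos_of_nonneg hb hc
  rcases h with h | h
  · have e : 2 * ρ * (o₂ - R) = b * c := by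
      rw [show o₁ = (b + c) / 2 by linarith] at h
      linear_combination -h - hR2
    have : b * c < 0 := by rw [← e]; exact mul_neg_of_pos_of_neg (by linarith) (by linarith)
    refine ⟨h, lt_of_le_of_ne hb ?_, lt_of_le_of_ne hc ?_, ho, e⟩
    · rintro rfl; simp at this
    · rintro rfl; simp at this
  -- External tangency would force `2ρ(o₂ + R) = bc ≤ 0`, whereas `|o₂| < R` because the chord has
  -- positive length.
  · exfalso
    have e : 2 * ρ * (o₂ + R) = b * c := by
      rw [show o₁ = (b + c) / 2 by linarith] at h
      linear_combination -h - hR2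
    have : 0 < 2 * ρ * (o₂ + R) := mul_pos (by linarith) (by linarith)
    linarith

/-- Of the two unit normals of the common tangents of two circles touching `Ω`, the contact point
of one lies on the positive side of the chord of `Ω` joining the contact points. -/
lemma normal_sign {N₁ N₂ σ k f₁ f₂ n₁ n₂ T w : ℝ} (hf : f₁ ^ 2 + f₂ ^ 2 = 1)
    (hn : n₁ ^ 2 + n₂ ^ 2 = 1) (hT : T ≠ 0) (hN : N₁ ^ 2 + N₂ ^ 2 = T ^ 2 + σ ^ 2)
    (hg : T ^ 2 = -2 * k * (σ + (N₁ * f₁ + N₂ * f₂))) (hdot : N₁ * n₁ + N₂ * n₂ = σ)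
    (hw : 0 < w)
    (hside : 0 ≤ ((N₁ + σ * f₁) * (n₂ + f₂) - (N₂ + σ * f₂) * (n₁ + f₁)) * (w * T)) :
    N₁ * n₂ - N₂ * n₁ = T := by
  have hT2 : 0 < T ^ 2 := by positivity
  have hsq : (N₁ * n₂ - N₂ * n₁ - T) * (N₁ * n₂ - N₂ * n₁ + T) = 0 := by
    have : (N₁ * n₂ - N₂ * n₁) ^ 2 + (N₁ * n₁ + N₂ * n₂) ^ 2
      = (N₁ ^ 2 + N₂ ^ 2) * (n₁ ^ 2 + n₂ ^ 2) := by ring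
    rw [hdot, hn, hN] at this
    linear_combination this
  rcases mul_eq_zero.1 hsq with h | h
  · linarith
  -- With cross product `-T`, the vector `n` is determined, and the side expression becomes a
  -- positive multiple of `T * x - (T² + σ² + σd)`, which is shown to be negative.
  exfalso
  have hNpos : 0 < T ^ 2 + σ ^ 2 := by positivity
  have e1 : n₁ * (T ^ 2 + σ ^ 2) = σ * N₁ + T * N₂ := by
    rw [← hN]; linear_combination N₁ * hdot - N₂ * h
  have e2 : n₂ * (T ^ 2 + σ ^ 2) = σ * N₂ - T * N₁ := by
    rw [← hN]; linear_combination N₂ * hdot + N₁ * h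
  have hd2 : (N₁ * f₁ + N₂ * f₂) ^ 2 + (N₁ * f₂ - N₂ * f₁) ^ 2 = T ^ 2 + σ ^ 2 := by
    linear_combination (N₁ ^ 2 + N₂ ^ 2) * hf + hN
  set d := N₁ * f₁ + N₂ * f₂ with hd
  set x := N₁ * f₂ - N₂ * f₁ with hx
  have e3 : (T ^ 2 + σ ^ 2) * ((N₁ + σ * f₁) * (n₂ + f₂) - (N₂ + σ * f₂) * (n₁ + f₁)) =
      T * (T * x - (T ^ 2 + σ ^ 2 + σ * d)) := by
    rw [hd, hx]
    linear_combination (N₁ + σ * f₁) * e2 - (N₂ + σ * f₂) * e1 - T * hN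
  have h1 : 0 ≤ T * x - (T ^ 2 + σ ^ 2 + σ * d) := by
    have h2 : 0 ≤ (T ^ 2 + σ ^ 2) *
      (((N₁ + σ * f₁) * (n₂ + f₂) - (N₂ + σ * f₂) * (n₁ + f₁)) * (w * T)) :=
      mul_nonneg hNpos.le hside
    have h3 : (T ^ 2 + σ ^ 2) *
      (((N₁ + σ * f₁) * (n₂ + f₂) - (N₂ + σ * f₂) * (n₁ + f₁)) * (w * T)) =
      (w * T ^ 2) * (T * x - (T ^ 2 + σ ^ 2 + σ * d)) := by linear_combination (w * T) * e3
    rw [h3] at h2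
    exact nonneg_of_mul_nonneg_right h2 (by positivity)
  have hgd : σ + d ≠ 0 := by intro h0; rw [h0] at hg; linarith
  -- By `hd2`, twice this quantity is `T² + (σ + d)² + x²`.
  have hM : 0 < T ^ 2 + σ ^ 2 + σ * d := by nlinarith [sq_nonneg (σ + d), sq_nonneg x]
  have key : (T ^ 2 + σ ^ 2 + σ * d) ^ 2 - (T * x) ^ 2 = (T ^ 2 + σ ^ 2) * (σ + d) ^ 2 := by
    linear_combination (-T ^ 2) * hd2
  have : 0 < (T ^ 2 + σ ^ 2) * (σ + d) ^ 2 := by positivity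
  nlinarith

/-- The length of the common tangent of `ω` and `ωa`, and its projections to the axes. -/
lemma contact_identities {b c ρ r p m u v s T : ℝ}
    (hu : u = p - m * r * (b + c - 2 * p)) (hv : v = r + m * ((p - b) * (c - p) + r ^ 2))
    (hs : s = m * ((p - b) * (c - p) - r ^ 2) - r) (hρ : ρ = -m * (b * c))
    (hT : T = p + m * r * (b + c)) :
    u ^ 2 + (v - ρ) ^ 2 = T ^ 2 + (s - ρ) ^ 2 ∧
      (p ^ 2 + r ^ 2) * T = u * (p ^ 2 - r ^ 2) + (v - ρ) * (2 * r * p) ∧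
      (p ^ 2 + r ^ 2) * (s - ρ) = -u * (2 * r * p) + (v - ρ) * (p ^ 2 - r ^ 2) := by
  subst hT hu hs hv hρ
  refine ⟨?_, ?_, ?_⟩ <;> ring

/-- The computational core, in coordinates with origin `D` and the line `BC` as first axis:
`(n₁, n₂)` is the unit normal of `k` and `(p, r)` the incenter. -/
lemma normal_eq {b c ρ r p m u v s R o₁ o₂ f₁ f₂ g₁ g₂ n₁ n₂ : ℝ} (hb : b < 0) (hc : 0 < c)
    (hρ : 0 < ρ) (hr : 0 < r) (ho : 2 * o₁ = b + c)
    (ho₂ : 2 * ρ * (o₂ - R) = b * c) (hB : (b - o₁) ^ 2 + o₂ ^ 2 = R ^ 2)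
    (hf : f₁ ^ 2 + f₂ ^ 2 = 1) (hf₁ : -o₁ = (R - ρ) * f₁) (hf₂ : ρ - o₂ = (R - ρ) * f₂)
    (hg : g₁ ^ 2 + g₂ ^ 2 = 1) (hg₁ : u - o₁ = (R - s) * g₁) (hg₂ : v - o₂ = (R - s) * g₂)
    (hu : u = p - m * r * (b + c - 2 * p)) (hv : v = r + m * ((p - b) * (c - p) + r ^ 2))
    (hs : s = m * ((p - b) * (c - p) - r ^ 2) - r) (hXY : 0 < (p - b) * (c - p)) (hvs : 0 < v - s)
    (hn : n₁ ^ 2 + n₂ ^ 2 = 1) (hk : n₁ * u + n₂ * (v - ρ) = s - ρ)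
    (hsel : (f₁ = g₁ ∧ f₂ = g₂) ∨ 0 ≤ ((g₁ - f₁) * (n₂ + f₂) - (g₂ - f₂) * (n₁ + f₁)) *
      ((g₁ - f₁) * (1 + f₂) - (g₂ - f₂) * f₁)) :
    n₁ * (p ^ 2 + r ^ 2) = -2 * r * p ∧ n₂ * (p ^ 2 + r ^ 2) = p ^ 2 - r ^ 2 := by
  have hbc : b * c < 0 := mul_neg_of_neg_of_pos hb hc
  have hmr : 0 < 1 + m * r := by
    have : v - s = 2 * r * (1 + m * r) := by rw [hv, hs]; ring
    rw [this] at hvs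
    exact pos_of_mul_pos_right hvs (by positivity)
  have hR' : R * (-4 * ρ * (b * c)) = (b * c) ^ 2 + ρ ^ 2 * (c - b) ^ 2 := by
    rw [show o₁ = (b + c) / 2 by linarith] at hB
    linear_combination (2 * ρ * (o₂ + R) + b * c) * ho₂ - 4 * ρ ^ 2 * hB
  have hk0 : 0 < R - ρ := by
    have : (R - ρ) * (-4 * ρ * (b * c)) = (b * c) ^ 2 + ρ ^ 2 * (b + c) ^ 2 := by
      linear_combination hR'
    have h1 : 0 < (b * c) ^ 2 + ρ ^ 2 * (b + c) ^ 2 :=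
      add_pos_of_pos_of_nonneg (sq_pos_of_neg hbc) (by positivity)
    rw [← this] at h1
    exact pos_of_mul_pos_left h1 (by nlinarith)
  have hQ : u ^ 2 + v ^ 2 - s ^ 2 - (b + c) * u - 2 * o₂ * v + 2 * R * s + b * c = 0 := by
    have : (u - o₁) ^ 2 + (v - o₂) ^ 2 = (R - s) ^ 2 := by
      rw [hg₁, hg₂]; linear_combination (R - s) ^ 2 * hg
    linear_combination this - hB + (u - b) * ho
  -- Tangency of `ωa` and `Ω`, with `R` and `o₂` eliminated, is a quadratic in `m`; its second
  -- factor is positive since `bc < 0` and `1 + mr > 0`.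
  have hρm : ρ = -m * (b * c) := by
    have h1 : (b * c * m + ρ) * (ρ * (c - b) ^ 2 * r * (1 + m * r)
        - b * c * ((p - b) * (c - p))) = 0 := by
      have h3 : b * c * ρ * (u ^ 2 + v ^ 2 - s ^ 2 - (b + c) * u + b * c)
          - ((b * c) ^ 2 - ρ ^ 2 * (c - b) ^ 2) / 2 * (v - s) - (b * c) ^ 2 * s = 0 := by
        linear_combination b * c * ρ * hQ + b * c * v * ho₂ - (v - s) / 2 * hR'
      rw [hu, hv, hs] at h3
      linear_combination h3
    have h2 : 0 < ρ * (c - b) ^ 2 * r * (1 + m * r) - b * c * ((p - b) * (c - p)) := by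
      have : b * c * ((p - b) * (c - p)) < 0 := mul_neg_of_neg_of_pos hbc hXY
      have : 0 ≤ ρ * (c - b) ^ 2 * r * (1 + m * r) := by positivity
      linarith
    rcases mul_eq_zero.1 h1 with h | h
    · linarith
    · linarith
  have hm : 0 < m := by
    by_contra h
    have := mul_nonneg_of_nonpos_of_nonpos (not_lt.1 h) hbc.le
    linarith
  obtain ⟨T, hT⟩ : ∃ T, T = p + m * r * (b + c) := ⟨_, rfl⟩
  obtain ⟨hN, hgood, hgood'⟩ := contact_identities hu hv hs hρm hT
  have hNT : u ^ 2 + (v - ρ) ^ 2 ≠ 0 := by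
    intro h
    have h2 := ((add_eq_zero_iff_of_nonneg (sq_nonneg _) (sq_nonneg _)).1 h).2
    have h3 := ((add_eq_zero_iff_of_nonneg (sq_nonneg _) (sq_nonneg _)).1 (hN.symm.trans h)).2
    rw [pow_eq_zero_iff two_ne_zero, sub_eq_zero] at h2 h3
    exact hvs.ne' (by rw [h2, h3, sub_self])
  -- The dot product (`hk`) and the cross product with the nonzero vector `(u, v - ρ)` determine
  -- `n`, and `contact_identities` says that the expected normal has the same two products.
  suffices h : u * n₂ - (v - ρ) * n₁ = T by
    constructor
    · apply mul_left_cancel₀ hNT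
      linear_combination (p ^ 2 + r ^ 2) * (u * hk - (v - ρ) * h) + u * hgood' - (v - ρ) * hgood
    · apply mul_left_cancel₀ hNT
      linear_combination (p ^ 2 + r ^ 2) * ((v - ρ) * hk + u * h) + (v - ρ) * hgood' + u * hgood
  have hTg : T ^ 2 = -2 * (R - ρ) * ((s - ρ) + (u * f₁ + (v - ρ) * f₂)) := by
    have h1 : u + (R - ρ) * f₁ = (R - s) * g₁ := by linarith
    have h2 : (v - ρ) + (R - ρ) * f₂ = (R - s) * g₂ := by linarith
    have h3 : (u + (R - ρ) * f₁) ^ 2 + ((v - ρ) + (R - ρ) * f₂) ^ 2 = (R - s) ^ 2 := by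
      rw [h1, h2]; linear_combination (R - s) ^ 2 * hg
    linear_combination h3 - (R - ρ) ^ 2 * hf - hN
  -- If `T = 0` the two candidate tangents coincide and no selection is needed.
  by_cases hT0 : T = 0
  · have : (u * n₂ - (v - ρ) * n₁) ^ 2 = 0 := by
      have : (u * n₂ - (v - ρ) * n₁) ^ 2 + (n₁ * u + n₂ * (v - ρ)) ^ 2
        = (u ^ 2 + (v - ρ) ^ 2) * (n₁ ^ 2 + n₂ ^ 2) := by ring
      rw [hk, hn, hN, hT0] at this
      linear_combination this
    rw [hT0]; exact pow_eq_zero_iff two_ne_zero |>.1 this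
  have c1 : (R - s) * (g₁ - f₁) = u + (s - ρ) * f₁ := by linear_combination -hg₁ + hf₁
  have c2 : (R - s) * (g₂ - f₂) = v - ρ + (s - ρ) * f₂ := by linear_combination -hg₂ + hf₂
  -- `κ` parametrizes the unit vector `f` rationally: `f = (-2κ, 1 - κ²) / (1 + κ²)`. Geometrically,
  -- `PD` has direction `(-κ, 1)`.
  obtain ⟨κ, hκ⟩ : ∃ κ, κ = m * (b + c) := ⟨_, rfl⟩
  have hm1 : 2 * m * (R - o₂) = 1 := by
    apply mul_left_cancel₀ hbc.ne
    rw [hρm] at ho₂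
    linear_combination ho₂
  have hm2 : 4 * m * (R - ρ) = 1 + κ ^ 2 := by
    apply mul_left_cancel₀ (pow_ne_zero 2 hbc.ne)
    rw [hρm] at hR' ⊢
    rw [hκ]
    linear_combination hR'
  have hκ1 : f₁ * (1 + κ ^ 2) = -2 * κ := by
    rw [hκ] at hm2 ⊢
    linear_combination (-f₁) * hm2 - 4 * m * hf₁ - 2 * m * ho
  have hκ2 : f₂ * (1 + κ ^ 2) = 1 - κ ^ 2 := by
    linear_combination (-1 - f₂) * hm2 - 4 * m * hf₂ + 2 * hm1
  have hκpos : 0 < 1 + κ ^ 2 := by positivity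
  -- The side of the chord `A'P` on which `D` lies is read off from the sign of `T`, up to the
  -- factor `R - s`, which later enters squared.
  have hD : (u + (s - ρ) * f₁) * (1 + f₂) - (v - ρ + (s - ρ) * f₂) * f₁
      = 2 * (1 + 2 * m * r) / (1 + κ ^ 2) * T := by
    rw [div_mul_eq_mul_div, eq_div_iff hκpos.ne']
    have h1 : 2 * u + 2 * κ * (v - s) = 2 * (1 + 2 * m * r) * T := by
      rw [hκ, hT, hu, hv, hs]; ring
    linear_combination u * hκ2 - (v - s) * hκ1 + h1
  refine normal_sign (f₁ := f₁) (f₂ := f₂) (w := 2 * (1 + 2 * m * r) / (1 + κ ^ 2)) hf hn hT0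
    hN hTg (by linarith) (by positivity) ?_
  rw [← hD, ← c1, ← c2]
  rcases hsel with ⟨h1, h2⟩ | h
  · simp [h1, h2]
  · have := mul_nonneg (sq_nonneg (R - s)) h
    linear_combination this

/-! ### Cartesian coordinates -/

/-- The affine functions `x` and `y` form a Cartesian coordinate system. -/
def IsCartesian (x y : Plane →ᵃ[ℝ] ℝ) : Prop :=
  ∀ X Y : Plane, dist X Y ^ 2 = (x X - x Y) ^ 2 + (y X - y Y) ^ 2

/-- The affine function `u X₀ + v X₁ - w`. -/
noncomputable def affineForm (u v w : ℝ) : Plane →ᵃ[ℝ] ℝ :=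
  (u • EuclideanSpace.proj (𝕜 := ℝ) (0 : Fin 2) +
    v • EuclideanSpace.proj (𝕜 := ℝ) (1 : Fin 2) : Plane →L[ℝ] ℝ).toLinearMap.toAffineMap -
    AffineMap.const ℝ Plane w

lemma affineForm_apply (u v w : ℝ) (X : Plane) : affineForm u v w X = u * X 0 + v * X 1 - w := by
  simp [affineForm]

lemma isCartesian_affineForm {i j u v w z : ℝ} (hij : i ^ 2 + j ^ 2 = 1)
    (huv : u = -j ∧ v = i ∨ u = j ∧ v = -i) :
    IsCartesian (affineForm i j w) (affineForm u v z) := by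
  intro X Y
  rw [EuclideanSpace.dist_eq, Real.sq_sqrt (by positivity)]
  simp only [Fin.sum_univ_two, Real.dist_eq, sq_abs, affineForm_apply]
  rcases huv with ⟨rfl, rfl⟩ | ⟨rfl, rfl⟩ <;>
    linear_combination (-((X 0 - Y 0) ^ 2 + (X 1 - Y 1) ^ 2)) * hij

/-- There are Cartesian coordinates with a given line `BC` as first axis, such that a given point
lies on the upper half of the second axis. -/
lemma exists_isCartesian {B C : Plane} (O : Plane) (h : B ≠ C) :
    ∃ x y : Plane →ᵃ[ℝ] ℝ, IsCartesian x y ∧ x O = 0 ∧ y B = 0 ∧ y C = 0 ∧ x B < x C ∧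
      0 ≤ y O := by
  set l := dist B C with hl
  have hl0 : 0 < l := dist_pos.2 h
  have hl2 : l ^ 2 = (B 0 - C 0) ^ 2 + (B 1 - C 1) ^ 2 := by
    rw [hl, EuclideanSpace.dist_eq, Real.sq_sqrt (by positivity)]
    simp [Fin.sum_univ_two, Real.dist_eq, sq_abs]
  set i := (C 0 - B 0) / l with hi
  set j := (C 1 - B 1) / l with hj
  have hi' : i * l = C 0 - B 0 := by rw [hi]; field_simp
  have hj' : j * l = C 1 - B 1 := by rw [hj]; field_simp
  have hij : i ^ 2 + j ^ 2 = 1 := by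
    apply mul_right_cancel₀ (pow_ne_zero 2 hl0.ne')
    linear_combination (i * l + C 0 - B 0) * hi' + (j * l + C 1 - B 1) * hj' - hl2
  have hC : j * (C 0 - B 0) = i * (C 1 - B 1) := by rw [← hi', ← hj']; ring
  have hBC : i * B 0 + j * B 1 < i * C 0 + j * C 1 := by
    have : i * (C 0 - B 0) + j * (C 1 - B 1) = l := by
      rw [← hi', ← hj']; linear_combination l * hij
    linarith
  -- The second axis is oriented according to the side of `BC` on which `O` lies.
  rcases le_total 0 (-j * (O 0 - B 0) + i * (O 1 - B 1)) with h0 | h0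
  · refine ⟨affineForm i j (i * O 0 + j * O 1), affineForm (-j) i (-j * B 0 + i * B 1),
      isCartesian_affineForm hij (.inl ⟨rfl, rfl⟩), ?_⟩
    simp only [affineForm_apply]
    refine ⟨?_, ?_, ?_, ?_, ?_⟩ <;> linarith
  · refine ⟨affineForm i j (i * O 0 + j * O 1), affineForm j (-i) (j * B 0 + -i * B 1),
      isCartesian_affineForm hij (.inr ⟨rfl, rfl⟩), ?_⟩
    simp only [affineForm_apply]
    refine ⟨?_, ?_, ?_, ?_, ?_⟩ <;> linarith

namespace IsCartesian

variable {x y : Plane →ᵃ[ℝ] ℝ} (h : IsCartesian x y)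

include h

lemma ext {X Y : Plane} (hx : x X = x Y) (hy : y X = y Y) : X = Y := by
  have := h X Y
  rw [hx, hy] at this
  simpa using this

lemma mem_sphere {s : Sphere Plane} {p : Plane} (hp : p ∈ s) :
    (x p - x s.center) ^ 2 + (y p - y s.center) ^ 2 = s.radius ^ 2 := by
  rw [← h, EuclideanGeometry.mem_sphere.1 hp]

lemma tangent_orthogonal {s : Sphere Plane} {p q : Plane} {l : AffineSubspace ℝ Plane}
    (ht : s.IsTangentAt p l) (hq : q ∈ l) :
    (x q - x p) * (x s.center - x p) + (y q - y p) * (y s.center - y p) = 0 := by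
  have h1 := ht.dist_sq_eq_of_mem hq
  rw [h, h, ← h.mem_sphere ht.mem_sphere] at h1
  linear_combination (-1 / 2) * h1

end IsCartesian

/-! ### Signed areas and sides of lines -/

/-- Twice the signed area of the triangle with vertices `X`, `Y` and the argument, in terms of
the coordinates `x` and `y`. -/
noncomputable def areaForm (x y : Plane →ᵃ[ℝ] ℝ) (X Y : Plane) : Plane →ᵃ[ℝ] ℝ :=
  (x Y - x X) • (y - AffineMap.const ℝ Plane (y X)) -
    (y Y - y X) • (x - AffineMap.const ℝ Plane (x X))

lemma areaForm_apply (x y : Plane →ᵃ[ℝ] ℝ) (X Y Z : Plane) :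
    areaForm x y X Y Z = (x Y - x X) * (y Z - y X) - (y Y - y X) * (x Z - x X) := by
  simp [areaForm]

lemma areaForm_eq_zero (x y : Plane →ᵃ[ℝ] ℝ) {X Y Z : Plane} (hZ : Z ∈ line[ℝ, X, Y]) :
    areaForm x y X Y Z = 0 := by
  obtain ⟨t, rfl⟩ := mem_affineSpan_pair_iff_exists_lineMap_eq.1 hZ
  rw [areaForm_apply, AffineMap.apply_lineMap, AffineMap.apply_lineMap,
    AffineMap.lineMap_apply_module', AffineMap.lineMap_apply_module', smul_eq_mul, smul_eq_mul]
  ring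

lemma IsCartesian.areaForm_center_sq {x y : Plane →ᵃ[ℝ] ℝ} (h : IsCartesian x y)
    {s : Sphere Plane} {X Y : Plane} (ht : s.IsTangent line[ℝ, X, Y]) :
    areaForm x y X Y s.center ^ 2 =
      s.radius ^ 2 * ((x Y - x X) ^ 2 + (y Y - y X) ^ 2) := by
  obtain ⟨p, hp⟩ := ht
  have h1 := h.tangent_orthogonal hp (left_mem_affineSpan_pair ℝ X Y)
  have h2 := h.tangent_orthogonal hp (right_mem_affineSpan_pair ℝ X Y)
  have h3 := areaForm_eq_zero x y hp.mem_space
  have h4 := h.mem_sphere hp.mem_sphere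
  rw [areaForm_apply] at h3 ⊢
  have h5 : (x Y - x X) * (y s.center - y X) - (y Y - y X) * (x s.center - x X) =
      (x Y - x X) * (y s.center - y p) - (y Y - y X) * (x s.center - x p) := by
    linear_combination h3
  have h6 : (x Y - x X) * (x s.center - x p) + (y Y - y X) * (y s.center - y p) = 0 := by
    linear_combination h2 - h1
  rw [h5, ← h4]
  linear_combination (-((x Y - x X) * (x s.center - x p) + (y Y - y X) * (y s.center - y p))) * h6

lemma SameRay.mul_nonneg {a b : ℝ} (h : SameRay ℝ a b) : 0 ≤ a * b := by
  rcases h with rfl | rfl | ⟨r, s, hr, hs, h⟩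
  · simp
  · simp
  · have : r * (a * b) = s * b ^ 2 := by
      simp only [smul_eq_mul] at h
      linear_combination b * h
    exact nonneg_of_mul_nonneg_right (this ▸ by positivity) hr

lemma AffineSubspace.WSameSide.mul_nonneg {l : AffineSubspace ℝ Plane} {X Y : Plane}
    (h : l.WSameSide X Y) (g : Plane →ᵃ[ℝ] ℝ) (hg : ∀ p ∈ l, g p = 0) : 0 ≤ g X * g Y := by
  obtain ⟨p, hp, q, hq, hr⟩ := h
  have := (hr.map g.linear).mul_nonneg
  rw [g.linearMap_vsub, g.linearMap_vsub, hg p hp, hg q hq] at this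
  simpa using this

lemma AffineSubspace.WOppSide.mul_nonpos {l : AffineSubspace ℝ Plane} {X Y : Plane}
    (h : l.WOppSide X Y) (g : Plane →ᵃ[ℝ] ℝ) (hg : ∀ p ∈ l, g p = 0) : g X * g Y ≤ 0 := by
  obtain ⟨p, hp, q, hq, hr⟩ := h
  have := (hr.map g.linear).mul_nonneg
  rw [g.linearMap_vsub, g.linearMap_vsub, hg p hp, hg q hq] at this
  simpa using this

/-! ### Touching circles as homotheties -/

/-- The center of `s` is the image of the center of `t` under the homothety with center `p`. -/
lemma EuclideanGeometry.Sphere.IsIntTangentAt.homothety {s t : Sphere Plane} {p : Plane}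
    (h : s.IsIntTangentAt t p) (g : Plane →ᵃ[ℝ] ℝ) :
    t.radius * (g s.center - g t.center) = (t.radius - s.radius) * (g p - g t.center) := by
  obtain ⟨hs, ht, a, ⟨ha0, ha1⟩, ha⟩ := h
  have h1 : s.radius = (1 - a) * t.radius := by
    rw [← EuclideanGeometry.mem_sphere.1 hs, ← EuclideanGeometry.mem_sphere'.1 ht, ← ha,
      dist_comm, dist_lineMap_right, Real.norm_of_nonneg (by linarith)]
  rw [← ha, AffineMap.apply_lineMap, AffineMap.lineMap_apply_module', h1]
  simp only [smul_eq_mul]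
  ring

lemma EuclideanGeometry.Sphere.IsIntTangentAt.homothety' {s t : Sphere Plane} {p : Plane}
    (h : t.IsIntTangentAt s p) (g : Plane →ᵃ[ℝ] ℝ) :
    t.radius * (g s.center - g t.center) = (t.radius - s.radius) * (g p - g t.center) := by
  linear_combination -h.homothety g

lemma EuclideanGeometry.Sphere.IsExtTangentAt.homothety {s t : Sphere Plane} {p : Plane}
    (h : s.IsExtTangentAt t p) (g : Plane →ᵃ[ℝ] ℝ) :
    t.radius * (g s.center - g t.center) = (t.radius + s.radius) * (g p - g t.center) := by
  obtain ⟨hs, ht, a, ⟨ha0, ha1⟩, ha⟩ := h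
  have h1 : s.radius = a * dist s.center t.center := by
    rw [← EuclideanGeometry.mem_sphere.1 hs, ← ha, dist_lineMap_left, Real.norm_of_nonneg ha0]
  have h2 : t.radius = (1 - a) * dist s.center t.center := by
    rw [← EuclideanGeometry.mem_sphere.1 ht, ← ha, dist_lineMap_right,
      Real.norm_of_nonneg (by linarith)]
  rw [← ha, AffineMap.apply_lineMap, AffineMap.lineMap_apply_module', h1, h2]
  simp only [smul_eq_mul]
  ring

/-! ### Common tangent lines -/

/-- If `k` touches `s` at `E`, the linear form vanishing on `k` that defines its orthogonal
direction. -/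
noncomputable def normalForm (x y : Plane →ᵃ[ℝ] ℝ) (E O : Plane) : Plane →ᵃ[ℝ] ℝ :=
  (x O - x E) • (x - AffineMap.const ℝ Plane (x E)) +
    (y O - y E) • (y - AffineMap.const ℝ Plane (y E))

lemma normalForm_apply (x y : Plane →ᵃ[ℝ] ℝ) (E O Z : Plane) :
    normalForm x y E O Z = (x O - x E) * (x Z - x E) + (y O - y E) * (y Z - y E) := by
  simp [normalForm]

namespace IsCartesian

variable {x y : Plane →ᵃ[ℝ] ℝ} (h : IsCartesian x y) {s t : Sphere Plane}
  {k : AffineSubspace ℝ Plane} {E : Plane}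

include h

lemma normalForm_eq_zero (hE : s.IsTangentAt E k) : ∀ p ∈ k, normalForm x y E s.center p = 0 := by
  intro p hp
  rw [normalForm_apply]
  linear_combination h.tangent_orthogonal hE hp

lemma normalForm_center (hE : s.IsTangentAt E k) :
    normalForm x y E s.center s.center = s.radius ^ 2 := by
  rw [normalForm_apply, ← h.mem_sphere hE.mem_sphere]
  ring

/-- Both radii to the contact points are orthogonal to a nonzero direction of `k`, hence parallel in
the plane. The form at the center of `t` is their inner product, whose square is then the product of
their squared lengths. The sign is left to the side conditions. -/
lemma normalForm_sq (hk : Module.finrank ℝ k.direction = 1) (hE : s.IsTangentAt E k)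
    (ht : t.IsTangent k) :
    normalForm x y E s.center t.center ^ 2 = s.radius ^ 2 * t.radius ^ 2 := by
  obtain ⟨F, hF⟩ := ht
  have : Nontrivial k.direction := Module.nontrivial_of_finrank_pos (R := ℝ) (by omega)
  obtain ⟨⟨w, hw⟩, hw0⟩ := exists_ne (0 : k.direction)
  have hw0 : w ≠ 0 := by simpa using hw0
  have hG : w +ᵥ E ∈ k := AffineSubspace.vadd_mem_of_mem_direction hw hE.mem_space
  have hGE : w +ᵥ E ≠ E := by simpa using hw0
  generalize w +ᵥ E = G at hG hGE
  have h1 := h.tangent_orthogonal hE hG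
  have h2 := h.tangent_orthogonal hE hF.mem_space
  have h3 := h.tangent_orthogonal hF hG
  have h4 := h.tangent_orthogonal hF hE.mem_space
  have h5 := h.mem_sphere hE.mem_sphere
  have h6 := h.mem_sphere hF.mem_sphere
  have hne : (x G - x E) ^ 2 + (y G - y E) ^ 2 ≠ 0 := by
    rw [← h]; exact pow_ne_zero 2 (dist_ne_zero.2 hGE)
  have h7 : (x G - x E) * (x t.center - x F) + (y G - y E) * (y t.center - y F) = 0 := by
    linear_combination h3 - h4
  have hcr : (x s.center - x E) * (y t.center - y F) - (y s.center - y E) * (x t.center - x F)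
      = 0 := by
    apply mul_left_cancel₀ hne
    linear_combination ((x G - x E) * (y t.center - y F) - (y G - y E) * (x t.center - x F)) * h1 -
      ((x G - x E) * (y s.center - y E) - (y G - y E) * (x s.center - x E)) * h7
  have h8 : normalForm x y E s.center t.center =
      (x s.center - x E) * (x t.center - x F) + (y s.center - y E) * (y t.center - y F) := by
    rw [normalForm_apply]; linear_combination h2
  rw [h8, ← h5, ← h6]
  linear_combination (-((x s.center - x E) * (y t.center - y F) -
    (y s.center - y E) * (x t.center - x F))) * hcr

end IsCartesian

/-! ### Signed distances and the signed radius -/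

/-- Tangency gives a signed distance only up to sign; comparison with a reference value `G > 0` on a
known side fixes it. -/
lemma eq_mul_of_sq_eq {F G r l : ℝ} (hsq : F ^ 2 = r ^ 2 * l ^ 2) (hr : 0 ≤ r) (hl : 0 ≤ l)
    (hG : 0 < G) (h : 0 ≤ F * G) : F = r * l := by
  have hF : 0 ≤ F := nonneg_of_mul_nonneg_left h hG
  rw [← mul_pow] at hsq
  exact (sq_eq_sq₀ hF (mul_nonneg hr hl)).1 hsq

lemma eq_neg_mul_of_sq_eq {F G r l : ℝ} (hsq : F ^ 2 = r ^ 2 * l ^ 2) (hr : 0 ≤ r) (hl : 0 ≤ l)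
    (hG : 0 < G) (h : F * G ≤ 0) : F = -(r * l) := by
  have := eq_mul_of_sq_eq (F := -F) (by rw [neg_sq]; exact hsq) hr hl hG (by linarith)
  linarith

lemma incenter_tangent_sameSide (t : Affine.Triangle ℝ Plane) {i₁ i₂ i₃ : Fin 3} (h₁₂ : i₁ ≠ i₂)
    (h₁₃ : i₁ ≠ i₃) (h₂₃ : i₂ ≠ i₃) :
    t.insphere.IsTangent line[ℝ, t.points i₂, t.points i₃] ∧
      line[ℝ, t.points i₂, t.points i₃].WSameSide t.incenter (t.points i₁) := by
  have : Fact (Module.finrank ℝ Plane = 2) := ⟨by simp⟩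
  refine ⟨?_, (t.sSameSide_affineSpan_pair_incenter_point h₁₂ h₁₃ h₂₃).1⟩
  rw [t.affineSpan_pair_eq_orthRadius_insphere h₁₂ h₁₃ h₂₃]
  exact (Sphere.isTangentAt_orthRadius_iff_mem.2 (t.touchpoint_mem_insphere i₁)).isTangent

/-- The signed distance from the line through `X` and `Y`. -/
noncomputable def lineDist (x y : Plane →ᵃ[ℝ] ℝ) (X Y Z : Plane) : ℝ :=
  areaForm x y X Y Z / dist X Y

lemma IsCartesian.lineDist_sq {x y : Plane →ᵃ[ℝ] ℝ} (h : IsCartesian x y) {X Y : Plane}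
    (hXY : X ≠ Y) {s : Sphere Plane} (ht : s.IsTangent line[ℝ, X, Y]) :
    lineDist x y X Y s.center ^ 2 = s.radius ^ 2 := by
  have := h.areaForm_center_sq ht
  rw [lineDist, div_pow, this, dist_comm, h Y X, mul_div_assoc, div_self, mul_one]
  rw [← h]
  exact pow_ne_zero 2 (dist_ne_zero.2 hXY.symm)

lemma lineDist_mul_nonneg (x y : Plane →ᵃ[ℝ] ℝ) {X Y Z W : Plane}
    (h : line[ℝ, X, Y].WSameSide Z W) : 0 ≤ lineDist x y X Y Z * lineDist x y X Y W := by
  have := h.mul_nonneg (areaForm x y X Y) fun p hp => areaForm_eq_zero x y hp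
  rw [lineDist, lineDist, div_mul_div_comm]
  exact div_nonneg this (by positivity)

lemma lineDist_mul_nonpos (x y : Plane →ᵃ[ℝ] ℝ) {X Y Z W : Plane}
    (h : line[ℝ, X, Y].WOppSide Z W) : lineDist x y X Y Z * lineDist x y X Y W ≤ 0 := by
  have := h.mul_nonpos (areaForm x y X Y) fun p hp => areaForm_eq_zero x y hp
  rw [lineDist, lineDist, div_mul_div_comm]
  exact div_nonpos_of_nonpos_of_nonneg this (by positivity)

/-- The three configurations in a uniform way: `ωa` has a signed radius `s`, positive in the
vertical angle and negative in the angle `BAC`. -/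
lemma exists_signed_radius {x y : Plane →ᵃ[ℝ] ℝ} (h : IsCartesian x y) {A B C : Plane}
    {ωa Ω ω : Sphere Plane} {k : AffineSubspace ℝ Plane} {A' E : Plane} (hAB' : A ≠ B)
    (hAC' : A ≠ C) (hAB : ωa.IsTangent line[ℝ, A, B]) (hAC : ωa.IsTangent line[ℝ, A, C])
    (hk : Module.finrank ℝ k.direction = 1) (hka : ωa.IsTangent k) (hω : 0 < ω.radius)
    (hE : ω.IsTangentAt E k) (hC : 0 < lineDist x y A B C) (hB : lineDist x y A C B < 0)
    (hconf : VerticalConfig A B C ωa Ω ω k A' ∨ InnerConfig A B C ωa Ω ω k A' ∨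
      PointConfig ωa Ω A') :
    ∃ s : ℝ, lineDist x y A B ωa.center = -s ∧ lineDist x y A C ωa.center = s ∧
      (∀ g : Plane →ᵃ[ℝ] ℝ, Ω.radius * (g ωa.center - g Ω.center) =
        (Ω.radius - s) * (g A' - g Ω.center)) ∧
      normalForm x y E ω.center ωa.center = ω.radius * s ∧ A' ∈ Ω ∧
      -- This alternative later yields that the height of the center of `ωa` above `BC` exceeds `s`.
      (0 ≤ s ∨ s < 0 ∧ line[ℝ, B, C].WSameSide ωa.center A) := by
  have dB := h.lineDist_sq hAB' hAB
  have dC := h.lineDist_sq hAC' hAC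
  have nk := h.normalForm_sq hk hE hka
  have nE := h.normalForm_center hE
  have nE' : 0 < normalForm x y E ω.center ω.center := by rw [nE]; positivity
  have hr : 0 ≤ ωa.radius := by
    obtain ⟨p, hp⟩ := hka
    rw [← EuclideanGeometry.mem_sphere.1 hp.mem_sphere]
    exact dist_nonneg
  rw [← mul_one (ωa.radius ^ 2), ← one_pow 2] at dB dC
  rw [mul_comm] at nk
  rw [← neg_sq] at dC
  have hB' : 0 < -lineDist x y A C B := by linarith
  rcases hconf with hc | hc | hc
  · have h1 := eq_neg_mul_of_sq_eq dB hr zero_le_one hC (lineDist_mul_nonpos x y hc.opp_AB.1)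
    have h2 := eq_neg_mul_of_sq_eq dC hr zero_le_one hB'
      (by linarith [lineDist_mul_nonpos x y hc.opp_AC.1])
    have h3 := eq_mul_of_sq_eq nk hr hω.le nE' (by
      rw [mul_comm]; exact hc.side_k.1.mul_nonneg _ (h.normalForm_eq_zero hE))
    exact ⟨ωa.radius, by linarith, by linarith, hc.touch.homothety, by linarith,
      hc.touch.mem_right, .inl hr⟩
  · have h1 := eq_mul_of_sq_eq dB hr zero_le_one hC (lineDist_mul_nonneg x y hc.same_AB.1)
    have h2 := eq_mul_of_sq_eq dC hr zero_le_one hB'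
      (by linarith [lineDist_mul_nonneg x y hc.same_AC.1])
    have h3 := eq_neg_mul_of_sq_eq nk hr hω.le nE' (by
      rw [mul_comm]; exact hc.side_k.1.mul_nonpos _ (h.normalForm_eq_zero hE))
    refine ⟨-ωa.radius, by linarith, by linarith, ?_, by linarith,
      hc.touch.mem_right, .inr ⟨by linarith [hc.radius_pos], hc.same_BC.1⟩⟩
    intro g
    rw [hc.touch.homothety g, sub_neg_eq_add]
  · have hz := hc.radius_zero
    have hA' : A' = ωa.center := by
      have := EuclideanGeometry.mem_sphere.1 hc.mem_left
      rw [hz] at this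
      exact dist_eq_zero.1 this
    refine ⟨0, ?_, ?_, ?_, ?_, hc.mem_right, .inl le_rfl⟩
    · simpa [hz] using dB
    · simpa [hz] using dC
    · intro g; rw [hA', sub_zero]
    · simpa [hz] using nk

lemma CirclesTouchAt.homothety {s t : Sphere Plane} {p : Plane} (h : CirclesTouchAt s t p) :
    p ∈ s ∧ p ∈ t ∧
    ((∀ g : Plane →ᵃ[ℝ] ℝ, t.radius * (g s.center - g t.center) =
      (t.radius - s.radius) * (g p - g t.center)) ∨
    (∀ g : Plane →ᵃ[ℝ] ℝ, t.radius * (g s.center - g t.center) =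
      (t.radius + s.radius) * (g p - g t.center))) := by
  rcases h with h | h | h
  · exact ⟨h.mem_left, h.mem_right, .inr h.homothety⟩
  · exact ⟨h.mem_left, h.mem_right, .inl h.homothety⟩
  · exact ⟨h.mem_right, h.mem_left, .inl h.homothety'⟩

/-! ### The theorem in coordinates -/

/-- Generalized Sawayama Lemma. -/
theorem theorem2p3
    (A B C : Plane) (hABC : AffineIndependent ℝ ![A, B, C])
    (ωa Ω ω : Sphere Plane) (k : AffineSubspace ℝ Plane) (A' P D E : Plane)
    -- `ωa` touches the lines `AB` and `AC`; `Ω` passes through `B` and `C`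
    (hAB : ωa.IsTangent line[ℝ, A, B]) (hAC : ωa.IsTangent line[ℝ, A, C])
    (hB : B ∈ Ω) (hC : C ∈ Ω)
    -- `k` is a line touching `ωa`
    (hk : Module.finrank ℝ k.direction = 1) (hka : ωa.IsTangent k)
    -- `ω` touches the segment `BC` at `D`, the circle `Ω` at `P` and the line `k` at `E`,
    -- and lies on the same side of `BC` as `A`
    (hω : 0 < ω.radius)
    (hD : ω.IsTangentAt D line[ℝ, B, C]) (hDBC : D ∈ segment ℝ B C)
    (hP : CirclesTouchAt ω Ω P)
    (hE : ω.IsTangentAt E k)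
    (hside : line[ℝ, B, C].SSameSide ω.center A)
    -- the configuration; `A'` is the point where `ωa` touches `Ω`
    (hconf : VerticalConfig A B C ωa Ω ω k A' ∨ InnerConfig A B C ωa Ω ω k A' ∨
      PointConfig ωa Ω A')
    -- of the two admissible common tangents of `ωa` and `ω`, the line `k` is the one touching `ω`
    -- on the same side of `A'P` as `BC` does (nothing to choose if `A' = P`)
    (hsel : A' = P ∨ line[ℝ, A', P].SSameSide E D) :
    D ≠ E ∧ (⟨![A, B, C], hABC⟩ : Affine.Triangle ℝ Plane).incenter ∈ line[ℝ, D, E] := by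
  have hAB' : A ≠ B := fun h => by simpa using hABC.injective (a₁ := 0) (a₂ := 1) h
  have hAC' : A ≠ C := fun h => by simpa using hABC.injective (a₁ := 0) (a₂ := 2) h
  have hBC' : B ≠ C := fun h => by simpa using hABC.injective (a₁ := 1) (a₂ := 2) h
  obtain ⟨tBC, sBC⟩ := incenter_tangent_sameSide (⟨![A, B, C], hABC⟩ : Affine.Triangle ℝ Plane)
    (i₁ := 0) (i₂ := 1) (i₃ := 2) (by decide) (by decide) (by decide)
  obtain ⟨tAC, sAC⟩ := incenter_tangent_sameSide (⟨![A, B, C], hABC⟩ : Affine.Triangle ℝ Plane)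
    (i₁ := 1) (i₂ := 0) (i₃ := 2) (by decide) (by decide) (by decide)
  obtain ⟨tAB, sAB⟩ := incenter_tangent_sameSide (⟨![A, B, C], hABC⟩ : Affine.Triangle ℝ Plane)
    (i₁ := 2) (i₂ := 0) (i₃ := 1) (by decide) (by decide) (by decide)
  have hr := (⟨![A, B, C], hABC⟩ : Affine.Triangle ℝ Plane).inradius_pos
  rw [← Affine.Simplex.insphere_center] at sBC sAC sAB ⊢
  rw [← Affine.Simplex.insphere_radius] at hr
  -- From here on the incircle is just a circle of positive radius tangent to the three side lines,
  -- with its center on the inner side of each.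
  generalize (⟨![A, B, C], hABC⟩ : Affine.Triangle ℝ Plane).insphere = γ at *
  simp only [Matrix.cons_val_zero, Matrix.cons_val_one, Matrix.cons_val] at tBC sBC tAC sAC tAB sAB
  obtain ⟨x, y, h, hxO, hyB, hyC, hbc, hyO⟩ := exists_isCartesian ω.center hBC'
  -- the circle `ω`
  have hxD : x D = 0 := by
    have h1 := h.tangent_orthogonal hD (left_mem_affineSpan_pair ℝ B C)
    have h2 := h.tangent_orthogonal hD (right_mem_affineSpan_pair ℝ B C)
    apply mul_left_cancel₀ (sub_pos.2 hbc).ne'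
    rw [hxO] at h1 h2
    rw [hyB] at h1
    rw [hyC] at h2
    linear_combination h1 - h2
  have hyD : y D = 0 := by
    have := areaForm_eq_zero x y hD.mem_space
    rw [areaForm_apply, hyB, hyC] at this
    apply mul_left_cancel₀ (sub_pos.2 hbc).ne'
    linear_combination this
  have hρ : y ω.center = ω.radius := by
    have := h.mem_sphere hD.mem_sphere
    rw [hxD, hyD, hxO] at this
    exact (sq_eq_sq₀ hyO hω.le).1 (by linear_combination this)
  obtain ⟨hb0, hc0⟩ : x B ≤ 0 ∧ 0 ≤ x C := by
    rw [segment_eq_image_lineMap] at hDBC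
    obtain ⟨t, ⟨ht0, ht1⟩, rfl⟩ := hDBC
    rw [AffineMap.apply_lineMap, AffineMap.lineMap_apply_module', smul_eq_mul] at hxD
    constructor <;> nlinarith
  have hyA : 0 < y A := by
    have h1 := hside.1.mul_nonneg (areaForm x y B C) fun p hp => areaForm_eq_zero x y hp
    rw [areaForm_apply, areaForm_apply, hyB, hyC, hρ] at h1
    have h2 : 0 ≤ (ω.radius * (x C - x B) ^ 2) * y A := by linear_combination h1
    have h3 := sub_pos.2 hbc
    refine lt_of_le_of_ne (nonneg_of_mul_nonneg_right h2 (by positivity)) fun h4 => ?_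
    refine hside.2.2 ?_
    have : A = AffineMap.lineMap B C ((x A - x B) / (x C - x B)) := by
      apply h.ext
      · rw [AffineMap.apply_lineMap, AffineMap.lineMap_apply_module', smul_eq_mul]
        field_simp
        ring
      · rw [AffineMap.apply_lineMap, hyB, hyC, ← h4]; simp
    rw [this]
    exact AffineMap.lineMap_mem_affineSpan_pair _ _ _
  -- the lines `AB` and `AC`
  have hl : 0 < dist A B := dist_pos.2 hAB'
  have hl' : 0 < dist A C := dist_pos.2 hAC'
  have hlAB := h A B
  have hlAC := h A C
  rw [hyB] at hlAB
  rw [hyC] at hlAC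
  have eAB : ∀ Z, lineDist x y A B Z =
      y A / dist A B * (x Z - x B) + -(x A - x B) / dist A B * y Z := by
    intro Z
    rw [lineDist, areaForm_apply, hyB]
    field_simp
    ring
  have eAC : ∀ Z, lineDist x y A C Z =
      -(y A / dist A C * (x C - x Z) + (x A - x C) / dist A C * y Z) := by
    intro Z
    rw [lineDist, areaForm_apply, hyC]
    field_simp
    ring
  have hα : 0 < y A / dist A B := by positivity
  have hα' : 0 < y A / dist A C := by positivity
  have hu : (y A / dist A B) ^ 2 + (-(x A - x B) / dist A B) ^ 2 = 1 := by
    field_simp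
    linear_combination -hlAB
  have hu' : (y A / dist A C) ^ 2 + ((x A - x C) / dist A C) ^ 2 = 1 := by
    field_simp
    linear_combination -hlAC
  have hdC : 0 < lineDist x y A B C := by
    rw [eAB, hyC, mul_zero, add_zero]
    exact mul_pos hα (sub_pos.2 hbc)
  have hdB : lineDist x y A C B < 0 := by
    rw [eAC, hyB, mul_zero, add_zero]
    exact neg_neg_of_pos (mul_pos hα' (sub_pos.2 hbc))
  -- `A` has distance `0` from both sides; `-0` matches `bisector_param` with `s = 0`, which then
  -- yields `hW` from `y A > 0`.
  have hA : y A / dist A B * (x A - x B) + -(x A - x B) / dist A B * y A = -0 := by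
    field_simp
    ring
  have hA' : y A / dist A C * (x C - x A) + (x A - x C) / dist A C * y A = -0 := by
    field_simp
    ring
  have signBC : ∀ Z, line[ℝ, B, C].WSameSide Z A → 0 ≤ y Z := by
    intro Z hZ
    have h1 := hZ.mul_nonneg (areaForm x y B C) fun p hp => areaForm_eq_zero x y hp
    rw [areaForm_apply, areaForm_apply, hyB, hyC] at h1
    have h2 : 0 ≤ ((x C - x B) ^ 2 * y A) * y Z := by linear_combination h1
    have h3 := sub_pos.2 hbc
    exact nonneg_of_mul_nonneg_right h2 (by positivity)
  -- the incenter
  have hI : lineDist x y A B γ.center = γ.radius := by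
    have := eq_mul_of_sq_eq (l := 1) (by rw [h.lineDist_sq hAB' tAB]; ring) hr.le zero_le_one hdC
      (lineDist_mul_nonneg x y sAB)
    linarith
  have hI' : lineDist x y A C γ.center = -γ.radius := by
    have := eq_mul_of_sq_eq (F := -lineDist x y A C γ.center) (l := 1)
      (by rw [neg_sq, h.lineDist_sq hAC' tAC]; ring) hr.le zero_le_one (neg_pos.2 hdB)
      (by linarith [lineDist_mul_nonneg x y sAC])
    linarith
  have hyI : y γ.center = γ.radius := by
    have := h.areaForm_center_sq tBC
    rw [areaForm_apply, hyB, hyC] at this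
    refine (sq_eq_sq₀ (signBC _ sBC) hr.le).1 ?_
    apply mul_left_cancel₀ (pow_ne_zero 2 (sub_pos.2 hbc).ne')
    linear_combination this
  obtain ⟨s, hQ, hQ', hhom, hnQ, hA'Ω, hs⟩ := exists_signed_radius h hAB' hAC' hAB hAC hk hka hω hE
    hdC hdB hconf
  rw [eAB] at hI hQ
  rw [eAC, neg_eq_iff_eq_neg] at hI' hQ'
  rw [neg_neg] at hI'
  rw [hyI] at hI hI'
  have hX := (half_angle_formulas hα hr hu hI).1
  have hY := (half_angle_formulas hα' hr hu' hI').1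
  have hXY := mul_pos hX hY
  have hW : 0 < (x γ.center - x B) * (x C - x γ.center) - γ.radius ^ 2 := by
    have h1 := (bisector_param hα hα' hr hu hu' hI hI' hA hA').1
    refine pos_of_mul_pos_right (b := _) (a := y A) ?_ hyA.le
    rw [h1]
    positivity
  obtain ⟨hv, hu₁⟩ := bisector_param hα hα' hr hu hu' hI hI' hQ hQ'
  clear eAB eAC hα hα' hu hu' hdC hdB hA hA' hI hI' hQ hQ' hlAB hlAC
  obtain ⟨m, hm⟩ : ∃ m, s + γ.radius = m * ((x γ.center - x B) * (x C - x γ.center) -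
      γ.radius ^ 2) := ⟨_, (div_mul_cancel₀ _ hW.ne').symm⟩
  have hvs : 0 < y ωa.center - s := by
    rcases hs with hs | ⟨hs, hQA⟩
    · refine pos_of_mul_pos_left (b := (x γ.center - x B) * (x C - x γ.center) -
        γ.radius ^ 2) ?_ hW.le
      have h1 : (y ωa.center - s) * ((x γ.center - x B) * (x C - x γ.center) - γ.radius ^ 2) =
          2 * γ.radius * ((x γ.center - x B) * (x C - x γ.center)) +
            2 * s * γ.radius ^ 2 := by linear_combination hv
      rw [h1]
      positivity
    · linarith [signBC _ hQA]
  have hv' : y ωa.center = γ.radius +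
      m * ((x γ.center - x B) * (x C - x γ.center) + γ.radius ^ 2) := by
    apply mul_right_cancel₀ hW.ne'
    linear_combination hv + ((x γ.center - x B) * (x C - x γ.center) + γ.radius ^ 2) * hm
  have hu' : x ωa.center = x γ.center - m * γ.radius * (x B + x C - 2 * x γ.center) := by
    apply mul_right_cancel₀ hW.ne'
    linear_combination hu₁ - γ.radius * (x B + x C - 2 * x γ.center) * hm
  -- the circle `Ω`
  have hBΩ := h.mem_sphere hB
  have hCΩ := h.mem_sphere hC
  rw [hyB, zero_sub, neg_sq] at hBΩ
  rw [hyC, zero_sub, neg_sq] at hCΩ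
  have hR : 0 < Ω.radius := by
    refine lt_of_le_of_ne (EuclideanGeometry.mem_sphere.1 hB ▸ dist_nonneg) fun h0 => hBC' ?_
    rw [EuclideanGeometry.mem_sphere, ← h0, dist_eq_zero] at hB hC
    rw [hB, hC]
  obtain ⟨-, hPΩ, hPhom⟩ := hP.homothety
  have hPΩ' := h.mem_sphere hPΩ
  have hAΩ' := h.mem_sphere hA'Ω
  obtain ⟨f₁, hf₁⟩ : ∃ f, x P - x Ω.center = Ω.radius * f := ⟨_, (mul_div_cancel₀ _ hR.ne').symm⟩
  obtain ⟨f₂, hf₂⟩ : ∃ f, y P - y Ω.center = Ω.radius * f := ⟨_, (mul_div_cancel₀ _ hR.ne').symm⟩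
  obtain ⟨g₁, hg₁⟩ : ∃ f, x A' - x Ω.center = Ω.radius * f := ⟨_, (mul_div_cancel₀ _ hR.ne').symm⟩
  obtain ⟨g₂, hg₂⟩ : ∃ f, y A' - y Ω.center = Ω.radius * f := ⟨_, (mul_div_cancel₀ _ hR.ne').symm⟩
  have hf : f₁ ^ 2 + f₂ ^ 2 = 1 := by
    rw [hf₁, hf₂] at hPΩ'
    apply mul_left_cancel₀ (pow_ne_zero 2 hR.ne')
    linear_combination hPΩ'
  have hg : g₁ ^ 2 + g₂ ^ 2 = 1 := by
    rw [hg₁, hg₂] at hAΩ'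
    apply mul_left_cancel₀ (pow_ne_zero 2 hR.ne')
    linear_combination hAΩ'
  have hgu : x ωa.center - x Ω.center = (Ω.radius - s) * g₁ := by
    apply mul_left_cancel₀ hR.ne'
    rw [hhom x, hg₁]; ring
  have hgv : y ωa.center - y Ω.center = (Ω.radius - s) * g₂ := by
    apply mul_left_cancel₀ hR.ne'
    rw [hhom y, hg₂]; ring
  have hcirc := fun H => circle_through_touching hb0 hc0 hbc hω hR hBΩ hCΩ H
  obtain ⟨hfu, hfv⟩ : -x Ω.center = (Ω.radius - ω.radius) * f₁ ∧
      ω.radius - y Ω.center = (Ω.radius - ω.radius) * f₂ := by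
    rcases hPhom with H | H
    · constructor
      · apply mul_left_cancel₀ hR.ne'
        rw [← zero_sub, ← hxO, H x, hf₁]; ring
      · apply mul_left_cancel₀ hR.ne'
        linear_combination H y + (Ω.radius - ω.radius) * hf₂ - Ω.radius * hρ
    · exfalso
      have e1 : -x Ω.center = (Ω.radius + ω.radius) * f₁ := by
        apply mul_left_cancel₀ hR.ne'
        rw [← zero_sub, ← hxO, H x, hf₁]; ring
      have e2 : ω.radius - y Ω.center = (Ω.radius + ω.radius) * f₂ := by
        apply mul_left_cancel₀ hR.ne'
        linear_combination H y + (Ω.radius + ω.radius) * hf₂ - Ω.radius * hρ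
      have e3 : x Ω.center ^ 2 + (ω.radius - y Ω.center) ^ 2 = (Ω.radius + ω.radius) ^ 2 := by
        rw [← neg_sq, e1, e2]; linear_combination (Ω.radius + ω.radius) ^ 2 * hf
      -- `circle_through_touching` turns even the external equation into the internal one; the two
      -- differ by `4Rρ`.
      have e4 : 4 * (Ω.radius * ω.radius) = 0 := by
        linear_combination (hcirc (.inr e3)).1 - e3
      linarith [mul_pos hR hω]
  obtain ⟨-, hb, hc, ho, ho₂⟩ := hcirc (.inl (by
    rw [← neg_sq, hfu, hfv]; linear_combination (Ω.radius - ω.radius) ^ 2 * hf))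
  -- the line `k`
  obtain ⟨n₁, hn₁⟩ : ∃ n, x E = -(ω.radius * n) :=
    ⟨-x E / ω.radius, by rw [mul_div_cancel₀ _ hω.ne', neg_neg]⟩
  obtain ⟨n₂, hn₂⟩ : ∃ n, y E = ω.radius - ω.radius * n :=
    ⟨(ω.radius - y E) / ω.radius, by rw [mul_div_cancel₀ _ hω.ne']; ring⟩
  have hn : n₁ ^ 2 + n₂ ^ 2 = 1 := by
    have := h.normalForm_center hE
    rw [normalForm_apply, hxO, hρ, hn₁, hn₂] at this
    apply mul_left_cancel₀ (pow_ne_zero 2 hω.ne')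
    linear_combination this
  have hnk : n₁ * x ωa.center + n₂ * (y ωa.center - ω.radius) = s - ω.radius := by
    rw [normalForm_apply, hxO, hρ, hn₁, hn₂] at hnQ
    apply mul_left_cancel₀ hω.ne'
    linear_combination hnQ - ω.radius ^ 2 * hn
  have hsel' : (f₁ = g₁ ∧ f₂ = g₂) ∨ 0 ≤ ((g₁ - f₁) * (n₂ + f₂) - (g₂ - f₂) * (n₁ + f₁)) *
      ((g₁ - f₁) * (1 + f₂) - (g₂ - f₂) * f₁) := by
    rcases hsel with rfl | hsel
    · left
      exact ⟨mul_left_cancel₀ hR.ne' (hf₁.symm.trans hg₁),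
        mul_left_cancel₀ hR.ne' (hf₂.symm.trans hg₂)⟩
    · right
      -- In terms of unit vectors, `P - E = ρ(f + n)`, `P - D = ρ(f + (0, 1))` and `P - A' = R(f -
      -- g)`, so the product of the two signed areas is `(Rρ)²` times the required expression.
      have h1 := hsel.1.mul_nonneg (areaForm x y A' P) fun p hp => areaForm_eq_zero x y hp
      have hxPA : x P - x A' = Ω.radius * (f₁ - g₁) := by linear_combination hf₁ - hg₁
      have hyPA : y P - y A' = Ω.radius * (f₂ - g₂) := by linear_combination hf₂ - hg₂
      have hxA : x A' = ω.radius * f₁ - Ω.radius * (f₁ - g₁) := by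
        linear_combination hg₁ - hfu
      have hyA : y A' = ω.radius + ω.radius * f₂ - Ω.radius * (f₂ - g₂) := by
        linear_combination hg₂ - hfv
      rw [areaForm_apply, areaForm_apply, hxPA, hyPA, hxA, hyA, hxD, hyD, hn₁, hn₂] at h1
      refine nonneg_of_mul_nonneg_right (a := (Ω.radius * ω.radius) ^ 2) ?_ (by positivity)
      linear_combination h1
  obtain ⟨hres₁, hres₂⟩ := normal_eq hb hc hω hr ho ho₂ hBΩ hf hfu hfv hg hgu hgv hu' hv'
    (by linear_combination hm) hXY hvs hn hnk hsel'
  have hpr : 0 < x γ.center ^ 2 + γ.radius ^ 2 := by positivity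
  constructor
  · rintro rfl
    have : n₂ = 1 := by
      apply mul_left_cancel₀ hω.ne'
      linear_combination hn₂ - hyD
    rw [this] at hres₂
    linarith [pow_pos hr 2]
  -- The ratio inverts `E = 2ρr / (p² + r²) * (p, r)`, with `D` at the origin.
  · have : γ.center = AffineMap.lineMap D E
        ((x γ.center ^ 2 + γ.radius ^ 2) / (2 * ω.radius * γ.radius)) := by
      apply h.ext
      · rw [AffineMap.apply_lineMap, AffineMap.lineMap_apply_module', smul_eq_mul, hxD, hn₁]
        field_simp
        linear_combination ω.radius * hres₁
      · rw [AffineMap.apply_lineMap, AffineMap.lineMap_apply_module', smul_eq_mul, hyD, hn₂, hyI]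
        field_simp
        linear_combination ω.radius * hres₂
    rw [this]
    exact AffineMap.lineMap_mem_affineSpan_pair _ _ _
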